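/- Let $A_l\in\mathbb{R}^{m_l\times n_x}$, $b_l\in\mathbb{R}^{m_l}$, $A_f\in\mathbb{R}^{m_f\times n_x}$, $B_f\in\mathbb{R}^{m_f\times n_y}$, $b_f\in\mathbb{R}^{m_f}$, $d_1\in\mathbb{R}^{n_x}$, $d_2\in\mathbb{R}^{n_y}$, and assume that the polyhedron $$D=\{(x,y)\in\mathbb{R}^{n_x}\times\mathbb{R}^{n_y} : A_lx\le b_l,\ A_fx+B_fy\le b_f\}$$ is compact with nonempty interior. Let $X=\{x : \exists y,\ (x,y)\in D\}$. Let $c:\Omega\to\mathbb{S}_{n_y}$ be a random vector on a probability space $(\Omega,\Sigma,\mathbb{P})$ with values in the Euclidean unit sphere of $\mathbb{R}^{n_y}$, whose law is absolutely continuous with respect to the $(n_y-1)$-dimensional Hausdorff measure on the sphere, and let $(\hat c_i)_{i\ge 1}$ be independent random vectors (on some probability space) with the same law as $c$. For $x\in X$ let $y(x,\omega)$ be, for almost every $\omega$, a solution of $\min_y\{\langle c(\omega),y\rangle : A_fx+B_fy\le b_f\}$, and, with probability $1$, for all $i\geq 1$ and all $x\in X$ let $y_i(x)$ be a solution of $\min_y\{\langle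 \hat c_i,y\rangle : A_fx+B_fy\le b_f\}$. Consider the original problem $$\bar\nu=\min_{x\in X}\ \langle d_1,x\rangle+\mathbb{E}[\langle d_2,y(x,\omega)\rangle],$$ with solution set $\mathcal{S}$, and, for $N_0\ge 1$, the sample average approximation (SAA) problem $$\nu^*_{N_0}=\min_{x\in X}\ \langle d_1,x\rangle+\frac1{N_0}\sum_{i=1}^{N_0}\langle d_2,y_i(x)\rangle .$$ Then the expectation in the original problem is well defined (the integrand is integrable) for every $x\in X$, $\mathcal{S}\neq\emptyset$, and with probability $1$ the SAA problem has an optimal solution for every $N_0\ge1$ and the following hold. 1. For every choice of optimal solutions $x^*_{N_0}$ of the SAA problems, $d(x^*_{N_0},\mathcal{S})=\inf_{x\in\mathcal{S}}\|x^*_{N_0}-x\|\to 0$ as $N_0\to\infty$. 2. $\nu^*_{N_0}\to\bar\nu$ as $N_0\to\infty$. -/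

import Mathlib

open MeasureTheory ProbabilityTheory Filter Topology

noncomputable section

/-- The data of a linear bilevel problem without coupling constraints: `nx`, `ny` are the numbers
of variables of the leader and of the follower, `ml`, `mf` their numbers of constraints. -/
structure BilevelData (nx ny ml mf : ℕ) where
  Al : Matrix (Fin ml) (Fin nx) ℝ
  bl : Fin ml → ℝ
  Af : Matrix (Fin mf) (Fin nx) ℝ
  Bf : Matrix (Fin mf) (Fin ny) ℝ
  bf : Fin mf → ℝ
  d1 : EuclideanSpace ℝ (Fin nx)
  d2 : EuclideanSpace ℝ (Fin ny)

namespace BilevelData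

variable {nx ny ml mf : ℕ} (Q : BilevelData nx ny ml mf)

/-- Leader's constraints `A_l x ≤ b_l`. -/
def LeaderFeasible (x : EuclideanSpace ℝ (Fin nx)) : Prop :=
  Q.Al.mulVec x.ofLp ≤ Q.bl

/-- Feasible set of the follower, `{y : A_f x + B_f y ≤ b_f}`. -/
def followerSet (x : EuclideanSpace ℝ (Fin nx)) : Set (EuclideanSpace ℝ (Fin ny)) :=
  {y | Q.Af.mulVec x.ofLp + Q.Bf.mulVec y.ofLp ≤ Q.bf}

/-- Feasible set `D` of the high-point relaxation. -/
def D : Set (EuclideanSpace ℝ (Fin nx) × EuclideanSpace ℝ (Fin ny)) :=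
  {p | Q.LeaderFeasible p.1 ∧ p.2 ∈ Q.followerSet p.1}

/-- Feasible set `X` of the leader. -/
def X : Set (EuclideanSpace ℝ (Fin nx)) :=
  {x | ∃ y, (x, y) ∈ Q.D}

/-- Optimal solutions of the follower's problem `min {⟨c, y⟩ : A_f x + B_f y ≤ b_f}`. -/
def followerArgmin (x : EuclideanSpace ℝ (Fin nx)) (c : EuclideanSpace ℝ (Fin ny)) :
    Set (EuclideanSpace ℝ (Fin ny)) :=
  {y | y ∈ Q.followerSet x ∧ ∀ z ∈ Q.followerSet x, inner ℝ c y ≤ inner ℝ c z}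

/-- Leader's objective `⟨d₁, x⟩ + 𝔼[⟨d₂, y(x, ω)⟩]`, where `y x ω` is the follower's response. -/
def trueObjective {Ω : Type*} [MeasurableSpace Ω] (P : Measure Ω)
    (y : EuclideanSpace ℝ (Fin nx) → Ω → EuclideanSpace ℝ (Fin ny))
    (x : EuclideanSpace ℝ (Fin nx)) : ℝ :=
  inner ℝ Q.d1 x + ∫ ω, inner ℝ Q.d2 (y x ω) ∂P

/-- Sample average objective `⟨d₁, x⟩ + (1/N) ∑_{i < N} ⟨d₂, y_i(x)⟩`, where `y i x` is the
follower's response to `x` for the `i`-th sampled cost. -/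
def saaObjective (N : ℕ) (y : ℕ → EuclideanSpace ℝ (Fin nx) → EuclideanSpace ℝ (Fin ny))
    (x : EuclideanSpace ℝ (Fin nx)) : ℝ :=
  inner ℝ Q.d1 x + (1 / (N : ℝ)) * ∑ i ∈ Finset.range N, inner ℝ Q.d2 (y i x)

/-- Optimal solutions of `min_{x ∈ X} f x`. -/
def solutions (f : EuclideanSpace ℝ (Fin nx) → ℝ) : Set (EuclideanSpace ℝ (Fin nx)) :=
  {x | x ∈ Q.X ∧ ∀ z ∈ Q.X, f x ≤ f z}

/-- Optimal value of `min_{x ∈ X} f x`. -/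
def optimalValue (f : EuclideanSpace ℝ (Fin nx) → ℝ) : ℝ :=
  sInf (f '' Q.X)

end BilevelData

/-- A random vector with values in the unit sphere of `ℝⁿ` has a nonatomic distribution if its law
vanishes on the Borel sets that are null for the `(n - 1)`-dimensional Hausdorff measure. -/
def NonatomicDistribution {n : ℕ} {Ω : Type*} [MeasurableSpace Ω] (P : Measure Ω)
    (c : Ω → Metric.sphere (0 : EuclideanSpace ℝ (Fin n)) 1) : Prop :=
  ∀ O : Set (Metric.sphere (0 : EuclideanSpace ℝ (Fin n)) 1), MeasurableSet O →
    Measure.hausdorffMeasure ((n : ℝ) - 1) O = 0 → P (c ⁻¹' O) = 0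

end

/-! The sampled objectives converge uniformly on `X`, because the strong law of large numbers holds
in the Banach space `C(X, ℝ)`. To apply it, the follower's response must be a random continuous
function. A cost not orthogonal to any nontrivial kernel of a row subset of `B_f` has a unique
optimal response at every `x` (`followerArgmin_subsingleton`). The excluded costs lie in finitely
many great subspheres, so they have probability zero. The solution mapping has a closed graph and,
over `X`, takes values in a compact set, so on generic costs the response is jointly continuous in
cost and decision (`exists_continuous_response`). Currying gives a bounded measurable map from costs
to `C(X, ℝ)`. Uniform convergence on a compact set then yields convergence of minimizers and optimal
values. -/

/-! ### Closed graphs, great subspheres, stability of minimization -/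

/-- A function with closed graph and values in a compact set is continuous. -/
theorem continuous_of_isClosed_graph_of_isCompact {α β : Type*} [TopologicalSpace α]
    [TopologicalSpace β] {K : Set β} (hK : IsCompact K) {f : α → β} (hf : ∀ a, f a ∈ K)
    (hgraph : IsClosed {p : α × β | p.2 = f p.1}) : Continuous f := by
  have : CompactSpace K := isCompact_iff_compactSpace.mp hK
  rw [continuous_iff_isClosed]
  intro C hC
  have hcl : IsClosed {p : α × K | (p.2 : β) = f p.1 ∧ (p.2 : β) ∈ C} := by
    have h1 : Continuous fun p : α × K => (p.1, (p.2 : β)) := by fun_prop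
    have h2 : Continuous fun p : α × K => (p.2 : β) := by fun_prop
    exact (hgraph.preimage h1).inter (hC.preimage h2)
  -- The preimage of `C` is the projection of a closed set along a compact factor.
  convert isClosedMap_fst_of_compactSpace _ hcl
  ext a
  constructor
  · intro ha
    exact ⟨(a, ⟨f a, hf a⟩), ⟨rfl, ha⟩, rfl⟩
  · rintro ⟨⟨a', b⟩, ⟨h1, h2⟩, rfl⟩
    simpa [← h1] using h2

/-- The intersection of the unit sphere with a hyperplane through the origin is null for the
Hausdorff measure of codimension one. -/
theorem hausdorffMeasure_sphere_inter_orthogonal_eq_zero {n : ℕ}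
    {v : EuclideanSpace ℝ (Fin n)} (hv : v ≠ 0) :
    Measure.hausdorffMeasure ((n : ℝ) - 1)
      {c : Metric.sphere (0 : EuclideanSpace ℝ (Fin n)) 1 |
        inner ℝ v (c : EuclideanSpace ℝ (Fin n)) = 0}
      = 0 := by
  obtain _ | n := n
  · exact absurd (Subsingleton.elim v 0) hv
  have hfact : Fact (Module.finrank ℝ (EuclideanSpace ℝ (Fin (n + 1))) = n + 1) := ⟨by simp⟩
  have hrank : Module.finrank ℝ (ℝ ∙ v)ᗮ = n := Submodule.finrank_orthogonal_span_singleton hv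
  have hd : ((n + 1 : ℕ) : ℝ) - 1 = (Module.finrank ℝ (ℝ ∙ v)ᗮ : ℝ) := by
    rw [hrank]; push_cast; ring
  rw [hd]
  have hpos : (0 : ℝ) ≤ (Module.finrank ℝ (ℝ ∙ v)ᗮ : ℝ) := Nat.cast_nonneg _
  -- On the `n`-dimensional space `vᗮ`, Hausdorff measure is a Haar measure, for which spheres are
  -- null.
  have hsphere : Measure.hausdorffMeasure (Module.finrank ℝ (ℝ ∙ v)ᗮ : ℝ)
      (Metric.sphere (0 : (ℝ ∙ v)ᗮ) 1) = 0 :=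
    Measure.addHaar_sphere_of_ne_zero _ _ one_ne_zero
  rw [← (isometry_subtype_coe (s := Metric.sphere (0 : EuclideanSpace ℝ (Fin (n + 1)))
    1)).hausdorffMeasure_image (Or.inl hpos)]
  rw [← (ℝ ∙ v)ᗮ.subtypeₗᵢ.isometry.hausdorffMeasure_image (Or.inl hpos)] at hsphere
  refine measure_mono_null ?_ hsphere
  rintro _ ⟨c, hc, rfl⟩
  refine ⟨⟨c, Submodule.mem_orthogonal_singleton_iff_inner_right.mpr hc⟩, ?_, rfl⟩
  simp

/-- If `g N` converges uniformly to a continuous `g` on a compact set, the distance of minimizers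
of `g N` to the set of minimizers of `g` tends to zero. -/
theorem tendsto_infDist_minimizers {E : Type*} [PseudoMetricSpace E] {K S : Set E}
    (hK : IsCompact K) {g : E → ℝ} {G : ℕ → E → ℝ} (hg : ContinuousOn g K)
    (hS : S = {x | x ∈ K ∧ ∀ z ∈ K, g x ≤ g z}) (hne : S.Nonempty)
    (hG : TendstoUniformlyOn G g atTop K) {x : ℕ → E}
    (hx : ∀ᶠ N in atTop, x N ∈ K ∧ ∀ z ∈ K, G N (x N) ≤ G N z) :
    Tendsto (fun N => Metric.infDist (x N) S) atTop (𝓝 0) := by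
  obtain ⟨s, hs⟩ := hne
  obtain ⟨hsK, hsmin⟩ := hS ▸ hs
  rw [Metric.tendsto_nhds]
  intro ε hε
  -- By compactness, points at distance at least `ε` from `S` exceed the minimum by a uniform gap;
  -- errors below `δ / 2` cannot bridge it.
  obtain ⟨δ, hδ, hfar⟩ : ∃ δ > 0, ∀ z ∈ K, ε ≤ Metric.infDist z S → g s + δ ≤ g z := by
    have hcomp : IsCompact (K ∩ {z | ε ≤ Metric.infDist z S}) :=
      hK.inter_right (isClosed_le continuous_const (Metric.continuous_infDist_pt S))
    obtain hemp | hfne := (K ∩ {z | ε ≤ Metric.infDist z S}).eq_empty_or_nonempty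
    · exact ⟨1, one_pos, fun z hz hzε => (hemp.subset ⟨hz, hzε⟩).elim⟩
    · obtain ⟨w, ⟨hwK, hwε⟩, hw⟩ := hcomp.exists_isMinOn hfne (hg.mono Set.inter_subset_left)
      have hlt : g s < g w := by
        by_contra! hle
        have hwS : w ∈ S := hS ▸ ⟨hwK, fun z hz => hle.trans (hsmin z hz)⟩
        have : ε ≤ Metric.infDist w S := hwε
        rw [Metric.infDist_zero_of_mem hwS] at this
        linarith
      refine ⟨g w - g s, sub_pos.mpr hlt, fun z hz hzε => ?_⟩
      have : g w ≤ g z := hw ⟨hz, hzε⟩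
      linarith
  filter_upwards [hx, Metric.tendstoUniformlyOn_iff.mp hG (δ / 2) (by linarith)]
    with N ⟨hxK, hxmin⟩ hN
  rw [Real.dist_0_eq_abs, abs_of_nonneg Metric.infDist_nonneg]
  by_contra! hge
  have h1 := abs_lt.mp (Real.dist_eq _ _ ▸ hN _ hxK)
  have h2 := abs_lt.mp (Real.dist_eq _ _ ▸ hN _ hsK)
  linarith [hfar _ hxK hge, hxmin s hsK]

/-- Infima over `K` differ by at most a uniform error bound; boundedness below passes from `g` to `G
N`. -/
theorem tendsto_sInf_image {E : Type*} {K : Set E} (hne : K.Nonempty) {g : E → ℝ}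
    {G : ℕ → E → ℝ} (hbdd : BddBelow (g '' K)) (hG : TendstoUniformlyOn G g atTop K) :
    Tendsto (fun N => sInf (G N '' K)) atTop (𝓝 (sInf (g '' K))) := by
  rw [Metric.tendsto_nhds]
  intro ε hε
  filter_upwards [Metric.tendstoUniformlyOn_iff.mp hG (ε / 2) (by linarith)] with N hN
  have hN' : ∀ z ∈ K, g z - ε / 2 < G N z ∧ G N z < g z + ε / 2 := by
    intro z hz
    have := abs_lt.mp (Real.dist_eq _ _ ▸ hN z hz)
    constructor <;> linarith
  obtain ⟨b, hb⟩ := hbdd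
  have hb2 : BddBelow (G N '' K) := by
    refine ⟨b - ε / 2, ?_⟩
    rintro _ ⟨z, hz, rfl⟩
    linarith [hb ⟨z, hz, rfl⟩, (hN' z hz).1]
  have h1 : sInf (g '' K) - ε / 2 ≤ sInf (G N '' K) := by
    refine le_csInf (hne.image _) ?_
    rintro _ ⟨z, hz, rfl⟩
    linarith [csInf_le ⟨b, hb⟩ (Set.mem_image_of_mem g hz), (hN' z hz).1]
  have h2 : sInf (G N '' K) - ε / 2 ≤ sInf (g '' K) := by
    refine le_csInf (hne.image _) ?_
    rintro _ ⟨z, hz, rfl⟩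
    linarith [csInf_le hb2 (Set.mem_image_of_mem (G N) hz), (hN' z hz).2]
  rw [Real.dist_eq, abs_lt]
  constructor <;> linarith

namespace BilevelData

variable {nx ny ml mf : ℕ} (Q : BilevelData nx ny ml mf)

/-! ### Compactness and existence of responses -/

theorem isCompact_X (hcompact : IsCompact Q.D) : IsCompact Q.X := by
  convert hcompact.image continuous_fst
  ext x
  simp [X]

theorem mem_snd_image_D {x : EuclideanSpace ℝ (Fin nx)} (hx : x ∈ Q.X)
    {y : EuclideanSpace ℝ (Fin ny)} (hy : y ∈ Q.followerSet x) : y ∈ Prod.snd '' Q.D :=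
  let ⟨_, hz⟩ := hx
  ⟨(x, y), ⟨hz.1, hy⟩, rfl⟩

theorem isClosed_setOf_mem_followerSet :
    IsClosed {p : EuclideanSpace ℝ (Fin nx) × EuclideanSpace ℝ (Fin ny) |
      p.2 ∈ Q.followerSet p.1} := by
  have hcont : Continuous fun p : EuclideanSpace ℝ (Fin nx) × EuclideanSpace ℝ (Fin ny) =>
      Q.Af.mulVec p.1.ofLp + Q.Bf.mulVec p.2.ofLp := by
    refine Continuous.add ?_ ?_
    · exact continuous_const.matrix_mulVec ((PiLp.continuous_ofLp 2 _).comp continuous_fst)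
    · exact continuous_const.matrix_mulVec ((PiLp.continuous_ofLp 2 _).comp continuous_snd)
  exact isClosed_le hcont continuous_const

theorem followerArgmin_nonempty (hcompact : IsCompact Q.D) {x : EuclideanSpace ℝ (Fin nx)}
    (hx : x ∈ Q.X) (c : EuclideanSpace ℝ (Fin ny)) : (Q.followerArgmin x c).Nonempty := by
  have hclosed : IsClosed (Q.followerSet x) :=
    Q.isClosed_setOf_mem_followerSet.preimage (Continuous.prodMk_right x)
  have hcomp : IsCompact (Q.followerSet x) :=
    (hcompact.image continuous_snd).of_isClosed_subset hclosed fun y hy => Q.mem_snd_image_D hx hy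
  obtain ⟨z, hz⟩ := hx
  obtain ⟨y, hy, hmin⟩ := hcomp.exists_isMinOn ⟨z, hz.2⟩
    (f := fun y => inner ℝ c y) (by fun_prop)
  exact ⟨y, hy, fun w hw => hmin hw⟩

/-! ### Optimality conditions and closed graph -/

/-- The constraints of the follower that are active at `(x, y)`. -/
def activeSet (x : EuclideanSpace ℝ (Fin nx)) (y : EuclideanSpace ℝ (Fin ny)) : Set (Fin mf) :=
  {j | (Q.Af.mulVec x.ofLp + Q.Bf.mulVec y.ofLp) j = Q.bf j}

/-- A direction that does not increase any active constraint is feasible for small steps. -/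
theorem exists_add_smul_mem_followerSet {x : EuclideanSpace ℝ (Fin nx)}
    {y u : EuclideanSpace ℝ (Fin ny)} (hy : y ∈ Q.followerSet x)
    (hu : ∀ j ∈ Q.activeSet x y, Q.Bf.mulVec u.ofLp j ≤ 0) :
    ∃ t : ℝ, 0 < t ∧ y + t • u ∈ Q.followerSet x := by
  have key : ∀ j, ∀ᶠ t in 𝓝[>] (0 : ℝ),
      (Q.Af.mulVec x.ofLp + Q.Bf.mulVec y.ofLp) j + t * Q.Bf.mulVec u.ofLp j ≤ Q.bf j := by
    intro j
    by_cases hj : j ∈ Q.activeSet x y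
    · filter_upwards [self_mem_nhdsWithin] with t ht
      have h0 : (Q.Af.mulVec x.ofLp + Q.Bf.mulVec y.ofLp) j = Q.bf j := hj
      have ht' : (0 : ℝ) < t := ht
      nlinarith [hu j hj]
    · have hlt : (Q.Af.mulVec x.ofLp + Q.Bf.mulVec y.ofLp) j < Q.bf j := lt_of_le_of_ne (hy j) hj
      have hcont : Tendsto (fun t : ℝ => (Q.Af.mulVec x.ofLp + Q.Bf.mulVec y.ofLp) j
          + t * Q.Bf.mulVec u.ofLp j) (𝓝[>] 0)
          (𝓝 ((Q.Af.mulVec x.ofLp + Q.Bf.mulVec y.ofLp) j + 0 * Q.Bf.mulVec u.ofLp j)) :=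
        Continuous.continuousWithinAt (by fun_prop)
      rw [zero_mul, add_zero] at hcont
      exact (hcont.eventually_lt_const hlt).mono fun t ht => ht.le
  obtain ⟨t, ht, hpos⟩ := ((eventually_all.mpr key).and self_mem_nhdsWithin).exists
  refine ⟨t, hpos, fun j => ?_⟩
  have := ht j
  simp only [Pi.add_apply, WithLp.ofLp_add, WithLp.ofLp_smul, Matrix.mulVec_add,
    Matrix.mulVec_smul, Pi.smul_apply, smul_eq_mul] at this ⊢
  linarith

theorem inner_nonneg_of_mem_followerArgmin {x : EuclideanSpace ℝ (Fin nx)}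
    {c y u : EuclideanSpace ℝ (Fin ny)} (hy : y ∈ Q.followerArgmin x c)
    (hu : ∀ j ∈ Q.activeSet x y, Q.Bf.mulVec u.ofLp j ≤ 0) : 0 ≤ inner ℝ c u := by
  obtain ⟨t, ht, hfeas⟩ := Q.exists_add_smul_mem_followerSet hy.1 hu
  have := hy.2 _ hfeas
  rw [inner_add_right, inner_smul_right] at this
  exact nonneg_of_mul_nonneg_right (by linarith) ht

/-- First-order optimality conditions of the follower, with a certificate `J` of active
constraints ranging over a finite set. -/
theorem mem_followerArgmin_iff {x : EuclideanSpace ℝ (Fin nx)}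
    {c y : EuclideanSpace ℝ (Fin ny)} :
    y ∈ Q.followerArgmin x c ↔ ∃ J : Set (Fin mf), y ∈ Q.followerSet x ∧ J ⊆ Q.activeSet x y ∧
      ∀ u : EuclideanSpace ℝ (Fin ny), (∀ j ∈ J, Q.Bf.mulVec u.ofLp j ≤ 0) → 0 ≤ inner ℝ c u := by
  constructor
  · intro hy
    exact ⟨Q.activeSet x y, hy.1, subset_rfl, fun u hu => Q.inner_nonneg_of_mem_followerArgmin hy hu⟩
  · rintro ⟨J, hy, hJ, hopt⟩
    refine ⟨hy, fun z hz => ?_⟩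
    have := hopt (z - y) fun j hj => by
      have h1 : (Q.Af.mulVec x.ofLp + Q.Bf.mulVec y.ofLp) j = Q.bf j := hJ hj
      have h2 := hz j
      simp only [Pi.add_apply, WithLp.ofLp_sub, Matrix.mulVec_sub, Pi.sub_apply] at h1 h2 ⊢
      linarith
    rw [inner_sub_right] at this
    linarith

/-- The solution mapping of the follower has a closed graph. -/
theorem isClosed_setOf_mem_followerArgmin :
    IsClosed {p : (EuclideanSpace ℝ (Fin nx) × EuclideanSpace ℝ (Fin ny)) ×
      EuclideanSpace ℝ (Fin ny) | p.2 ∈ Q.followerArgmin p.1.1 p.1.2} := by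
  simp only [mem_followerArgmin_iff, Set.ofPred_exists]
  -- The active set varies with the point, but for a fixed `J` every condition is closed, and there
  -- are finitely many `J`.
  refine isClosed_iUnion_of_finite fun J => ?_
  simp only [Set.ofPred_and, Set.ofPred_forall, Set.subset_def, activeSet, Set.mem_ofPred_eq]
  refine IsClosed.inter ?_ (IsClosed.inter ?_ ?_)
  · exact Q.isClosed_setOf_mem_followerSet.preimage
      (f := fun p : (EuclideanSpace ℝ (Fin nx) × EuclideanSpace ℝ (Fin ny)) ×
        EuclideanSpace ℝ (Fin ny) => (p.1.1, p.2)) (by fun_prop)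
  · refine isClosed_iInter fun j => isClosed_iInter fun _ => isClosed_eq ?_ continuous_const
    refine (continuous_apply j).comp (Continuous.add ?_ ?_)
    · exact continuous_const.matrix_mulVec ((PiLp.continuous_ofLp 2 _).comp (by fun_prop))
    · exact continuous_const.matrix_mulVec ((PiLp.continuous_ofLp 2 _).comp (by fun_prop))
  · exact isClosed_iInter fun u => isClosed_iInter fun _ =>
      isClosed_le continuous_const (by fun_prop)

/-! ### Generic costs and uniqueness -/

/-- Costs for which no hyperplane certificate of non-uniqueness exists: whenever the rows of `B_f`
indexed by `J` annihilate a nonzero direction, the cost is not constant along all such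
directions. -/
def genericCosts : Set (Metric.sphere (0 : EuclideanSpace ℝ (Fin ny)) 1) :=
  {c | ∀ J : Set (Fin mf),
    (∃ v : EuclideanSpace ℝ (Fin ny), v ≠ 0 ∧ ∀ j ∈ J, Q.Bf.mulVec v.ofLp j = 0) →
    ∃ w : EuclideanSpace ℝ (Fin ny), (∀ j ∈ J, Q.Bf.mulVec w.ofLp j = 0) ∧
      inner ℝ w (c : EuclideanSpace ℝ (Fin ny)) ≠ 0}

theorem isOpen_genericCosts : IsOpen Q.genericCosts := by
  simp only [genericCosts, Set.ofPred_forall, Set.ofPred_exists, Set.ofPred_and]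
  refine isOpen_iInter_of_finite fun J => ?_
  refine isOpen_iInter_of_finite fun _ => isOpen_iUnion fun w => ?_
  refine IsOpen.inter
    (isOpen_iInter_of_finite fun _ => isOpen_iInter_of_finite fun _ => isOpen_const) ?_
  exact isOpen_ne_fun (by fun_prop) continuous_const

/-- For each of the finitely many `J`, the bad costs are orthogonal to a whole nonzero kernel, hence
to one nonzero vector. -/
theorem hausdorffMeasure_compl_genericCosts :
    Measure.hausdorffMeasure ((ny : ℝ) - 1) Q.genericCostsᶜ = 0 := by
  have hsub : Q.genericCostsᶜ ⊆ ⋃ J : Set (Fin mf),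
      {c | (∃ v : EuclideanSpace ℝ (Fin ny), v ≠ 0 ∧ ∀ j ∈ J, Q.Bf.mulVec v.ofLp j = 0) ∧
        ∀ w : EuclideanSpace ℝ (Fin ny), (∀ j ∈ J, Q.Bf.mulVec w.ofLp j = 0) →
          inner ℝ w (c : EuclideanSpace ℝ (Fin ny)) = 0} := by
    intro c hc
    by_contra h
    refine hc fun J hJ => ?_
    by_contra! hw
    exact h (Set.mem_iUnion.mpr ⟨J, hJ, hw⟩)
  refine measure_mono_null hsub ((measure_iUnion_null_iff).mpr fun J => ?_)
  by_cases hJ : ∃ v : EuclideanSpace ℝ (Fin ny), v ≠ 0 ∧ ∀ j ∈ J, Q.Bf.mulVec v.ofLp j = 0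
  · obtain ⟨v, hv, hvJ⟩ := hJ
    exact measure_mono_null (fun c hc => hc.2 v hvJ)
      (hausdorffMeasure_sphere_inter_orthogonal_eq_zero hv)
  · simp only [hJ, false_and, Set.ofPred_false, measure_empty]

/-- For a generic cost the follower's solution is unique for every leader's decision. -/
theorem followerArgmin_subsingleton {c : Metric.sphere (0 : EuclideanSpace ℝ (Fin ny)) 1}
    (hc : c ∈ Q.genericCosts) (x : EuclideanSpace ℝ (Fin nx)) :
    (Q.followerArgmin x c).Subsingleton := by
  intro y hy z hz
  by_contra hne
  have hmid (j : Fin mf) : (Q.Af.mulVec x.ofLp +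
      Q.Bf.mulVec ((1 / 2 : ℝ) • (y + z)).ofLp) j =
      (1 / 2) * (Q.Af.mulVec x.ofLp + Q.Bf.mulVec y.ofLp) j +
      (1 / 2) * (Q.Af.mulVec x.ofLp + Q.Bf.mulVec z.ofLp) j := by
    simp only [Pi.add_apply, WithLp.ofLp_add, WithLp.ofLp_smul, Matrix.mulVec_add,
      Matrix.mulVec_smul, Pi.smul_apply, smul_eq_mul]
    ring
  -- Constraints active at the midpoint are active at both `y` and `z`, so their rows annihilate `y
  -- - z`; testing `w` and `-w` at the midpoint then forces `⟨c, w⟩ = 0`.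
  have hm : (1 / 2 : ℝ) • (y + z) ∈ Q.followerArgmin x c := by
    refine ⟨fun j => ?_, fun w hw => ?_⟩
    · rw [hmid]
      linarith [hy.1 j, hz.1 j]
    · rw [inner_smul_right, inner_add_right]
      linarith [hy.2 w hw, hz.2 w hw]
  obtain ⟨w, hw, hwc⟩ := hc (Q.activeSet x ((1 / 2 : ℝ) • (y + z))) ⟨y - z, sub_ne_zero.mpr hne, by
    intro j hj
    have h0 : _ = Q.bf j := hj
    rw [hmid] at h0
    have h1 := hy.1 j
    have h2 := hz.1 j
    simp only [Pi.add_apply, WithLp.ofLp_sub, Matrix.mulVec_sub, Pi.sub_apply] at h0 h1 h2 ⊢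
    linarith⟩
  refine hwc ?_
  rw [real_inner_comm]
  refine le_antisymm ?_ (Q.inner_nonneg_of_mem_followerArgmin hm fun j hj => (hw j hj).le)
  have := Q.inner_nonneg_of_mem_followerArgmin (u := -w) hm fun j hj => by
    simp [Matrix.mulVec_neg, hw j hj]
  rw [inner_neg_right] at this
  linarith

/-! ### The response as an element of `C(X, ℝ)` -/

/-- The leader's cost `⟨d₂, y(x, c)⟩` of the follower's response, as a continuous function of the
generic cost `c` and of the decision `x ∈ X`. -/
theorem exists_continuous_response (hcompact : IsCompact Q.D) :
    ∃ Φ : C(Q.genericCosts × Q.X, ℝ), ∀ (c : Q.genericCosts) (x : Q.X),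
      ∀ y ∈ Q.followerArgmin x c.1,
        inner ℝ Q.d2 y = Φ (c, x) := by
  choose Y hY using fun p : Q.genericCosts × Q.X =>
    Q.followerArgmin_nonempty hcompact p.2.2 p.1.1
  have huniq : ∀ (p : Q.genericCosts × Q.X),
      ∀ y ∈ Q.followerArgmin p.2 p.1.1, y = Y p :=
    fun p y hy => Q.followerArgmin_subsingleton p.1.2 _ hy (hY p)
  have hcont : Continuous Y := by
    refine continuous_of_isClosed_graph_of_isCompact (hcompact.image continuous_snd)
      (fun p => Q.mem_snd_image_D p.2.2 (hY p).1) ?_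
    have hcl := Q.isClosed_setOf_mem_followerArgmin.preimage
      (f := fun q : (Q.genericCosts × Q.X) × EuclideanSpace ℝ (Fin ny) =>
        (((q.1.2 : EuclideanSpace ℝ (Fin nx)),
          (q.1.1.1 : EuclideanSpace ℝ (Fin ny))), q.2)) (by fun_prop)
    convert hcl using 1
    ext q
    exact ⟨fun h => by
      have h' : q.2 = Y q.1 := h
      simpa [h'] using hY q.1, fun h => huniq q.1 q.2 h⟩
  exact ⟨⟨fun p => inner ℝ Q.d2 (Y p), by fun_prop⟩, fun c x y hy => by
    rw [huniq (c, x) y hy]; rfl⟩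

/-- The leader's cost of the follower's response, as a bounded measurable function of the cost with
values in the space of continuous functions on `X`. -/
theorem exists_measurable_response (hcompact : IsCompact Q.D) [CompactSpace Q.X]
    [MeasurableSpace C(Q.X, ℝ)] [BorelSpace C(Q.X, ℝ)] :
    ∃ F : Metric.sphere (0 : EuclideanSpace ℝ (Fin ny)) 1 → C(Q.X, ℝ), Measurable F ∧
      ∃ M : ℝ, (∀ c, ‖F c‖ ≤ M) ∧ ∀ c ∈ Q.genericCosts, ∀ x : Q.X,
        ∀ y ∈ Q.followerArgmin x c, inner ℝ Q.d2 y = F c x := by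
  classical
  obtain ⟨Φ, hΦ⟩ := Q.exists_continuous_response hcompact
  obtain ⟨R, hR⟩ := (hcompact.image continuous_snd).isBounded.exists_norm_le
  -- The value 0 on the exceptional costs keeps the map measurable, since the generic set is open.
  refine ⟨fun c => if h : c ∈ Q.genericCosts then Φ.curry ⟨c, h⟩ else 0,
    Measurable.dite Φ.curry.continuous.measurable measurable_const
      Q.isOpen_genericCosts.measurableSet, ‖Q.d2‖ * max R 0, fun c => ?_,
    fun c hc x y hy => ?_⟩
  · have hM : 0 ≤ ‖Q.d2‖ * max R 0 := by positivity
    rw [ContinuousMap.norm_le _ hM]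
    intro x
    by_cases h : c ∈ Q.genericCosts
    · obtain ⟨y, hy⟩ := Q.followerArgmin_nonempty hcompact x.2 (c : EuclideanSpace ℝ (Fin ny))
      simp only [dif_pos h]
      rw [ContinuousMap.curry_apply, ← hΦ ⟨c, h⟩ x y hy]
      exact (norm_inner_le_norm _ _).trans (mul_le_mul_of_nonneg_left
        ((hR y (Q.mem_snd_image_D x.2 hy.1)).trans (le_max_left _ _)) (norm_nonneg _))
    · simpa [dif_neg h] using hM
  · simp only [dif_pos hc]
    exact hΦ ⟨c, hc⟩ x y hy

end BilevelData

/-! ### Law of large numbers and conclusion -/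

theorem mainTheorem4 {nx ny ml mf : ℕ} (Q : BilevelData nx ny ml mf)
    (hcompact : IsCompact Q.D) (hfull : (interior Q.D).Nonempty)
    {Ω : Type*} [MeasurableSpace Ω] (P : Measure Ω) [IsProbabilityMeasure P]
    (c : Ω → Metric.sphere (0 : EuclideanSpace ℝ (Fin ny)) 1)
    (hc : Measurable c) (hnonatomic : NonatomicDistribution P c)
    -- the follower's response `y(x, ω)` in the original problem
    (y : EuclideanSpace ℝ (Fin nx) → Ω → EuclideanSpace ℝ (Fin ny))
    (hy : ∀ x ∈ Q.X, ∀ᵐ ω ∂P, y x ω ∈ Q.followerArgmin x (c ω))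
    -- the independent sample of the random cost
    {Ω' : Type*} [MeasurableSpace Ω'] (P' : Measure Ω') [IsProbabilityMeasure P']
    (chat : ℕ → Ω' → Metric.sphere (0 : EuclideanSpace ℝ (Fin ny)) 1)
    (hindep : iIndepFun chat P') (hident : ∀ i, IdentDistrib (chat i) c P' P)
    -- the follower's responses `y_i(x)` to the sampled costs
    (yhat : Ω' → ℕ → EuclideanSpace ℝ (Fin nx) → EuclideanSpace ℝ (Fin ny))
    (hyhat : ∀ᵐ ω' ∂P', ∀ i, ∀ x ∈ Q.X, yhat ω' i x ∈ Q.followerArgmin x (chat i ω')) :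
    -- the original problem is well defined and has solutions
    (∀ x ∈ Q.X, Integrable (fun ω => inner ℝ Q.d2 (y x ω)) P) ∧
    (Q.solutions (Q.trueObjective P y)).Nonempty ∧
    ∀ᵐ ω' ∂P',
      (∀ N : ℕ, 0 < N → (Q.solutions (Q.saaObjective N (yhat ω'))).Nonempty) ∧
      (∀ xstar : ℕ → EuclideanSpace ℝ (Fin nx),
        (∀ N : ℕ, 0 < N → xstar N ∈ Q.solutions (Q.saaObjective N (yhat ω'))) →
        Tendsto (fun N => Metric.infDist (xstar N) (Q.solutions (Q.trueObjective P y)))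
          atTop (𝓝 0)) ∧
      Tendsto (fun N => Q.optimalValue (Q.saaObjective N (yhat ω'))) atTop
        (𝓝 (Q.optimalValue (Q.trueObjective P y))) := by
  have hXc : IsCompact Q.X := Q.isCompact_X hcompact
  have : CompactSpace Q.X := isCompact_iff_compactSpace.mp hXc
  have hXne : Q.X.Nonempty :=
    let ⟨p, hp⟩ := hfull
    ⟨p.1, p.2, interior_subset hp⟩
  borelize C(Q.X, ℝ)
  obtain ⟨F, hF, M, hFM, hFeq⟩ := Q.exists_measurable_response hcompact
  have hgood : ∀ᵐ ω ∂P, c ω ∈ Q.genericCosts :=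
    hnonatomic _ Q.isOpen_genericCosts.measurableSet.compl Q.hausdorffMeasure_compl_genericCosts
  have hgood' : ∀ᵐ ω' ∂P', ∀ i, chat i ω' ∈ Q.genericCosts :=
    ae_all_iff.mpr fun i =>
      (hident i).symm.ae_snd Q.isOpen_genericCosts.measurableSet hgood
  have hint : Integrable (fun ω => F (c ω)) P :=
    Integrable.of_bound (hF.comp hc).aestronglyMeasurable M (ae_of_all _ fun ω => hFM _)
  have hident' (i : ℕ) : IdentDistrib (fun ω' => F (chat i ω')) (fun ω => F (c ω)) P' P :=
    (hident i).comp hF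
  have hyF (x : Q.X) : (fun ω => F (c ω) x) =ᵐ[P] fun ω => inner ℝ Q.d2 (y x ω) := by
    filter_upwards [hgood, hy x x.2] with ω hω hyω
    exact (hFeq _ hω x _ hyω).symm
  have hintx (x : Q.X) : Integrable (fun ω => F (c ω) x) P :=
    -- Evaluation at `x` is continuous and linear, so it commutes with the Bochner integral.
    (ContinuousMap.evalCLM ℝ x).integrable_comp hint
  have htrue (x : Q.X) : Q.trueObjective P y x =
      inner ℝ Q.d1 (x : EuclideanSpace ℝ (Fin nx)) + (∫ ω, F (c ω) ∂P) x := by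
    rw [BilevelData.trueObjective, ← integral_congr_ae (hyF x)]
    congr 1
    exact (ContinuousMap.evalCLM ℝ x).integral_comp_comm hint
  have hcont : ContinuousOn (Q.trueObjective P y) Q.X := by
    rw [continuousOn_iff_continuous_domRestrict]
    refine Continuous.congr (f := fun x : Q.X => inner ℝ Q.d1 (x : EuclideanSpace ℝ (Fin nx)) +
      (∫ ω, F (c ω) ∂P) x) (by fun_prop) fun x => (htrue x).symm
  have hne : (Q.solutions (Q.trueObjective P y)).Nonempty :=
    let ⟨x, hx, hmin⟩ := hXc.exists_isMinOn hXne hcont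
    ⟨x, hx, fun z hz => hmin hz⟩
  refine ⟨fun x hx => (hintx ⟨x, hx⟩).congr (hyF ⟨x, hx⟩), hne, ?_⟩
  -- Norm convergence in `C(X, ℝ)` gives one null set for all `x` and uniformity in `x`.
  have hlln := strong_law_ae (fun i ω' => F (chat i ω')) ((hident' 0).integrable_iff.mpr hint)
    (fun i j hij => (hindep.indepFun hij).comp hF hF)
    (fun i => (hident' i).trans (hident' 0).symm)
  filter_upwards [hgood', hyhat, hlln] with ω' hω' hyω' hlim
  rw [(hident' 0).integral_eq] at hlim
  have hsaa (N : ℕ) (x : Q.X) : Q.saaObjective N (yhat ω') x =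
      inner ℝ Q.d1 (x : EuclideanSpace ℝ (Fin nx)) +
        ((N : ℝ)⁻¹ • ∑ i ∈ Finset.range N, F (chat i ω')) x := by
    simp only [BilevelData.saaObjective, ContinuousMap.smul_apply, ContinuousMap.sum_apply,
      smul_eq_mul, one_div]
    congr 2
    exact Finset.sum_congr rfl fun i _ => hFeq _ (hω' i) x _ (hyω' i x x.2)
  have hunif : TendstoUniformlyOn (fun N => Q.saaObjective N (yhat ω')) (Q.trueObjective P y)
      atTop Q.X := by
    rw [Metric.tendstoUniformlyOn_iff]
    intro ε hε
    filter_upwards [Metric.tendsto_nhds.mp hlim ε hε] with N hN x hx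
    rw [htrue ⟨x, hx⟩, hsaa N ⟨x, hx⟩, dist_add_left, dist_comm]
    exact (ContinuousMap.dist_apply_le_dist _).trans_lt hN
  refine ⟨fun N _ => ?_, fun xstar hxstar => ?_, ?_⟩
  · have hcontN : ContinuousOn (Q.saaObjective N (yhat ω')) Q.X := by
      rw [continuousOn_iff_continuous_domRestrict]
      exact Continuous.congr (f := fun x : Q.X => inner ℝ Q.d1 (x : EuclideanSpace ℝ (Fin nx)) +
        ((N : ℝ)⁻¹ • ∑ i ∈ Finset.range N, F (chat i ω')) x) (by fun_prop)
        fun x => (hsaa N x).symm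
    obtain ⟨x, hx, hmin⟩ := hXc.exists_isMinOn hXne hcontN
    exact ⟨x, hx, fun z hz => hmin hz⟩
  · exact tendsto_infDist_minimizers hXc hcont rfl hne hunif
      ((eventually_gt_atTop 0).mono fun N hN => hxstar N hN)
  · exact tendsto_sInf_image hXne (hXc.bddBelow_image hcont) hunif
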